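/- Let $G$ be a (discrete) group, and let $\mathrm{Prob}(G)\subset\ell^1(G)$ be the set of probability measures on $G$, with the $\ell^1$-norm topology and the $G$-action $(s.f)(g)=f(s^{-1}g)$. An action of $G$ by homeomorphisms on a compact Hausdorff space $X$ is called topologically amenable if there is a net of continuous maps $m_i\colon X\to\mathrm{Prob}(G)$ such that $\lim_i\sup_{x\in X}\|m_i(s.x)-s.m_i(x)\|_1=0$ for every $s\in G$. The group $G$ is called exact if it admits a topologically amenable action on some nonempty compact Hausdorff space, and bi-exact if it is exact and there exists a map $\mu\colon G\to\mathrm{Prob}(G)$ such that for all $s,t\in G$ $$\lim_{x\to\infty}\|\mu(sxt)-s.\mu(x)\|_1=0,$$ where $x\to\infty$ means that $x$ leaves every finite subset of $G$. **Lemma.** Every subgroup of a countable bi-exact group is bi-exact. -/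

import Mathlib

open Filter Topology
open scoped ENNReal

universe u

/-- The set `Prob(G)` of probability measures on the discrete set `G`, as a subset of `ℓ¹(G)`
with the `ℓ¹`-norm and its topology. -/
def Prob (G : Type u) : Set (lp (fun _ : G => ℝ) 1) :=
  {f | (∀ g, 0 ≤ f g) ∧ HasSum (fun g => f g) 1}

/-- Left translates of elements of `ℓ¹(G)` are in `ℓ¹(G)`. -/
theorem memlp_translate {G : Type u} [Group G] (s : G) (f : lp (fun _ : G => ℝ) 1) :
    Memℓp (fun g => f (s⁻¹ * g) : G → ℝ) 1 := by
  have hf := (memℓp_gen_iff (p := 1) (by simp)).1 (lp.memℓp f)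
  refine (memℓp_gen_iff (by simp)).2 ?_
  exact (Equiv.mulLeft s⁻¹).summable_iff.2 hf

/-- Left translation of probability measures, `(s.f)(g) = f(s⁻¹ g)`, that is, the push-forward
of `f` under `g ↦ s g`. -/
def Prob.translate {G : Type u} [Group G] (s : G) (f : Prob G) : Prob G :=
  ⟨⟨fun g => f.1 (s⁻¹ * g), memlp_translate s f.1⟩,
    fun g => f.2.1 (s⁻¹ * g), (Equiv.mulLeft s⁻¹).hasSum_iff.2 f.2.2⟩

/-- Topological amenability of an action of a (discrete) group `G` on a space `X`: there are
continuous maps `m : X → Prob(G)` that are approximately equivariant, uniformly on `X`. The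
finite sets `F` and the numbers `ε > 0` index the usual net `(mᵢ)` of continuous maps with
`limᵢ sup_x ‖mᵢ(s.x) - s.mᵢ(x)‖₁ = 0` for every `s`. -/
def IsTopologicallyAmenable (G : Type u) [Group G] (X : Type u) [TopologicalSpace X]
    [MulAction G X] : Prop :=
  ∀ (F : Finset G) (ε : ℝ), 0 < ε → ∃ m : X → Prob G, Continuous m ∧
    ∀ s ∈ F, ∀ x : X, ‖(m (s • x)).1 - (Prob.translate s (m x)).1‖ ≤ ε

/-- A discrete group `G` is exact if it acts topologically amenably, by homeomorphisms, on some
nonempty compact Hausdorff space. (Restricting the space to the universe of `G` loses nothing: an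
amenable action on any such `X` pulls back along an orbit map `βG → X`.) -/
def IsExactGroup (G : Type u) [Group G] : Prop :=
  ∃ (X : Type u) (_ : TopologicalSpace X) (_ : CompactSpace X) (_ : T2Space X) (_ : Nonempty X)
    (_ : MulAction G X) (_ : ContinuousConstSMul G X), IsTopologicallyAmenable G X

/-- A group `G` is bi-exact if it is exact and there is a map `μ : G → Prob(G)` such that
`‖μ(s x t) - s.μ(x)‖₁ → 0` as `x → ∞` in the discrete set `G`, for all `s, t ∈ G`. -/
def IsBiExact (G : Type u) [Group G] : Prop :=
  IsExactGroup G ∧ ∃ μ : G → Prob G, ∀ s t : G,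
    Tendsto (fun x : G => ‖(μ (s * x * t)).1 - (Prob.translate s (μ x)).1‖) cofinite (𝓝 0)

/-! A right transversal `T` gives `G = HT`, and `ht ↦ h` is a left `H`-equivariant map `φ : G → H`.
Push-forward along `φ` sends `Prob G` to `Prob H`, contracts the `ℓ¹`-distance and commutes with
translation by `H`. Composing with it therefore carries both the maps `m` witnessing exactness and
the restriction of `μ` to `H` over to `H`, without worsening any estimate. -/

theorem lp_one_summable_norm {G : Type u} (f : lp (fun _ : G => ℝ) 1) :
    Summable fun g => ‖f g‖ := by
  simpa using (memℓp_gen_iff (p := 1) (by simp)).1 (lp.memℓp f)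

theorem lp_one_norm_eq_tsum {G : Type u} (f : lp (fun _ : G => ℝ) 1) :
    ‖f‖ = ∑' g, ‖f g‖ := by
  simpa using lp.norm_eq_tsum_rpow (p := 1) (by simp) f

theorem lp_one_summable_fiber {G K : Type u} (φ : G → K) (f : lp (fun _ : G => ℝ) 1) (k : K) :
    Summable fun g : {g // φ g = k} => f g :=
  (lp_one_summable_norm f).of_norm.subtype {g | φ g = k}

/-- The norms of the elements of a summable family, grouped along the fibers of a map. -/
theorem lp_one_hasSum_norm_fiber {G K : Type u} (φ : G → K) (f : lp (fun _ : G => ℝ) 1) :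
    HasSum (fun k => ∑' g : {g // φ g = k}, ‖f g‖) ‖f‖ := by
  have h : HasSum (fun p : Σ k, {g // φ g = k} => ‖f p.2‖) ‖f‖ := by
    rw [lp_one_norm_eq_tsum]
    exact (Equiv.sigmaFiberEquiv φ).hasSum_iff.2 (lp_one_summable_norm f).hasSum
  exact h.sigma fun k => ((lp_one_summable_norm f).subtype {g | φ g = k}).hasSum

theorem norm_tsum_fiber_le {G K : Type u} (φ : G → K) (f : lp (fun _ : G => ℝ) 1) (k : K) :
    ‖∑' g : {g // φ g = k}, f g‖ ≤ ∑' g : {g // φ g = k}, ‖f g‖ :=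
  norm_tsum_le_tsum_norm ((lp_one_summable_norm f).subtype {g | φ g = k})

/-- Push-forward of elements of `ℓ¹` along a map of index sets. -/
noncomputable def lpPush {G K : Type u} (φ : G → K) (f : lp (fun _ : G => ℝ) 1) :
    lp (fun _ : K => ℝ) 1 :=
  ⟨fun k => ∑' g : {g // φ g = k}, f g, (memℓp_gen_iff (by simp)).2 (by
    simpa using (lp_one_hasSum_norm_fiber φ f).summable.of_nonneg_of_le
      (fun _ => norm_nonneg _) (norm_tsum_fiber_le φ f))⟩

theorem lpPush_apply {G K : Type u} (φ : G → K) (f : lp (fun _ : G => ℝ) 1) (k : K) :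
    lpPush φ f k = ∑' g : {g // φ g = k}, f g := rfl

/-- Triangle inequality on each fiber, then summation over the fibers. -/
theorem norm_lpPush_le {G K : Type u} (φ : G → K) (f : lp (fun _ : G => ℝ) 1) :
    ‖lpPush φ f‖ ≤ ‖f‖ := by
  have h := lp_one_hasSum_norm_fiber φ f
  rw [lp_one_norm_eq_tsum (lpPush φ f), ← h.tsum_eq]
  exact (lp_one_summable_norm (lpPush φ f)).tsum_le_tsum (norm_tsum_fiber_le φ f) h.summable

theorem lpPush_sub {G K : Type u} (φ : G → K) (f f' : lp (fun _ : G => ℝ) 1) :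
    lpPush φ (f - f') = lpPush φ f - lpPush φ f' := by
  ext k
  rw [lp.coeFn_sub, Pi.sub_apply]
  simp only [lpPush_apply, lp.coeFn_sub, Pi.sub_apply]
  exact (lp_one_summable_fiber φ f k).tsum_sub (lp_one_summable_fiber φ f' k)

theorem norm_lpPush_sub_le {G K : Type u} (φ : G → K) (f f' : lp (fun _ : G => ℝ) 1) :
    ‖lpPush φ f - lpPush φ f'‖ ≤ ‖f - f'‖ :=
  lpPush_sub φ f f' ▸ norm_lpPush_le φ (f - f')

/-- Push-forward of probability measures. -/
noncomputable def Prob.push {G K : Type u} (φ : G → K) (f : Prob G) : Prob K :=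
  ⟨lpPush φ f.1, fun _ => tsum_nonneg fun g => f.2.1 g, by
    have h : HasSum (fun p : Σ k, {g // φ g = k} => f.1 p.2) 1 :=
      (Equiv.sigmaFiberEquiv φ).hasSum_iff.2 f.2.2
    exact h.sigma fun k => (lp_one_summable_fiber φ f.1 k).hasSum⟩

theorem Prob.continuous_push {G K : Type u} (φ : G → K) : Continuous (Prob.push φ) := by
  refine (LipschitzWith.of_dist_le_mul (K := 1) fun f f' => ?_).continuous
  rw [NNReal.coe_one, one_mul, Subtype.dist_eq, Subtype.dist_eq, dist_eq_norm, dist_eq_norm]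
  exact norm_lpPush_sub_le φ f.1 f'.1

/-- Push-forward along an `H`-equivariant map `G → H` is `H`-equivariant. -/
theorem Prob.push_translate {G : Type u} [Group G] {H : Subgroup G} {φ : G → H}
    (hφ : ∀ (s : H) (g : G), φ (s * g) = s * φ g) (s : H) (f : Prob G) :
    Prob.push φ (Prob.translate (s : G) f) = Prob.translate s (Prob.push φ f) := by
  refine Subtype.ext (lp.ext (funext fun k => ?_))
  -- By equivariance, left multiplication by `s⁻¹` carries the fiber over `k` onto the fiber over
  -- `s⁻¹ * k`.
  let e : {g // φ g = k} ≃ {g // φ g = s⁻¹ * k} :=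
    (Equiv.mulLeft (s : G)⁻¹).subtypeEquiv fun g => by
      have h := hφ s⁻¹ g
      rw [Subgroup.coe_inv] at h
      rw [Equiv.coe_mulLeft, h, mul_right_inj]
  exact e.tsum_eq fun g => f.1 g

/-- The estimate behind both halves of bi-exactness: pushing forward cannot increase the defect of
equivariance. -/
theorem Prob.norm_push_sub_translate_le {G : Type u} [Group G] {H : Subgroup G} {φ : G → H}
    (hφ : ∀ (s : H) (g : G), φ (s * g) = s * φ g) (s : H) (f f' : Prob G) :
    ‖(Prob.push φ f').1 - (Prob.translate s (Prob.push φ f)).1‖ ≤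
      ‖f'.1 - (Prob.translate (s : G) f).1‖ := by
  rw [← Prob.push_translate hφ]
  exact norm_lpPush_sub_le φ _ _

theorem Subgroup.exists_equivariant_map {G : Type u} [Group G] (H : Subgroup G) :
    ∃ φ : G → H, ∀ (s : H) (g : G), φ (s * g) = s * φ g := by
  obtain ⟨T, hT, -⟩ := H.exists_isComplement_right 1
  exact ⟨fun g => (hT.equiv g).1, fun s g => congrArg Prod.fst (hT.equiv_mul_left s g)⟩

theorem IsExactGroup.subgroup {G : Type u} [Group G] (hG : IsExactGroup G) (H : Subgroup G) :
    IsExactGroup H := by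
  obtain ⟨φ, hφ⟩ := H.exists_equivariant_map
  obtain ⟨X, _, _, _, _, _, _, hX⟩ := hG
  -- The same space works, with the action restricted to `H`.
  refine ⟨X, inferInstance, inferInstance, inferInstance, inferInstance, inferInstance,
    ⟨fun s => continuous_const_smul (s : G)⟩, fun F ε hε => ?_⟩
  obtain ⟨m, hm, hmF⟩ := hX (F.map (Function.Embedding.subtype _)) ε hε
  refine ⟨fun x => Prob.push φ (m x), (Prob.continuous_push φ).comp hm, fun s hs x => ?_⟩
  exact (Prob.norm_push_sub_translate_le hφ s _ _).trans
    (hmF s (Finset.mem_map_of_mem (Function.Embedding.subtype _) hs) x)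

theorem lemma3p15 {G : Type u} [Group G] [Countable G] (hG : IsBiExact G) (H : Subgroup G) :
    IsBiExact H := by
  obtain ⟨hex, μ, hμ⟩ := hG
  obtain ⟨φ, hφ⟩ := H.exists_equivariant_map
  refine ⟨hex.subgroup H, fun x => Prob.push φ (μ x), fun s t => ?_⟩
  exact squeeze_zero (fun _ => norm_nonneg _)
    (fun x => Prob.norm_push_sub_translate_le hφ s (μ x) (μ (s * x * t)))
    -- Since `H → G` is injective, `x → ∞` in `H` implies `x → ∞` in `G`.
    ((hμ s t).comp Subtype.val_injective.tendsto_cofinite)
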